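/- Let $k$ be an algebraically closed field and let $\sigma \subseteq \mathbb{R}^n$ be a full-dimensional simplicial strongly convex rational polyhedral cone; that is, $\sigma = \operatorname{Cone}(G)$ for some $G \subseteq \mathbb{Z}^n$ that is an $\mathbb{R}$-basis of $\mathbb{R}^n$. Let $\sigma^\vee$ be the dual cone of $\sigma$ with respect to the dot product, let $R = k[\sigma^\vee \cap \mathbb{Z}^n]$ be the corresponding toric ring (the semigroup ring, a Noetherian normal domain), and let $U_\sigma = \operatorname{Spec}(R)$. A primitive ray generator of $\sigma$ is a vector of $\mathbb{Z}^n$ whose coordinates have greatest common divisor one and which lies on a one-dimensional face of $\sigma$. Then: 1. $\sigma$ has exactly $n$ primitive ray generators $v_1, \dots, v_n$. Let $A_G \in \operatorname{Mat}_{n \times n}(\mathbb{Z})$ be the matrix with rows $v_1, \dots, v_n$ (in any order) and put $D = |\det A_G|$. Then $D$ is the volume of the $n$-parallelotope $\{\sum_i t_i v_i : 0 \le t_i \le 1\}$. 2. The divisor class group $\operatorname{Cl}(U_\sigma) = \operatorname{Cl}(R)$ is finite of order $D$. Here $\operatorname{Cl}(R)$ is the free abelian group on the height one primes of $R$ modulo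 the relations $a_1 P_1 + \dots + a_r P_r = 0$ whenever $P_1^{(a_1)} \cap \dots \cap P_r^{(a_r)}$ is principal, with symbolic powers as in (3). 3. $R$ satisfies the uniform symbolic topology property on ideals of pure height one with multiplier $D$: we have $D > 0$, and for every proper ideal $\mathfrak{q} \subsetneq R$ all of whose associated primes have height one and every integer $a > 0$, $$\mathfrak{q}^{(Da)} \subseteq \mathfrak{q}^a .$$ Here, for a proper ideal $I$ of $R$, the symbolic power is $I^{(m)} = I^m W^{-1}R \cap R$ with $W = R \setminus \bigcup \{P : P \in \operatorname{Ass}_R(R/I)\}$. -/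

import Mathlib

namespace ToricUSTP

/-! ### Symbolic powers, pure height one, divisor class group -/

section Algebra

variable {R : Type*} [CommRing R]

/-- The multiplicative set `W = R - ⋃ {P : P ∈ Ass_R (R / I)}`. -/
def assComplement (I : Ideal R) : Submonoid R where
  carrier := {r | ∀ P ∈ associatedPrimes R (R ⧸ I), r ∉ P}
  one_mem' := fun P hP h1 => hP.isPrime.ne_top ((Ideal.eq_top_iff_one P).2 h1)
  mul_mem' := fun {_ _} hx hy P hP hxy =>
    (hP.isPrime.mem_or_mem hxy).elim (hx P hP) (hy P hP)

/-- The symbolic power `I^(a) = I^a W⁻¹R ∩ R`, where `W = R - ⋃ Ass_R (R / I)`.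
For `I = P` prime, `W = R - P` and this is `P^a R_P ∩ R`. -/
def symbolicPower (I : Ideal R) (a : ℕ) : Ideal R :=
  Ideal.comap (algebraMap R (Localization (assComplement I)))
    (Ideal.map (algebraMap R (Localization (assComplement I))) (I ^ a))

/-- A proper ideal all of whose associated primes have height one. -/
def IsPureHeightOne (I : Ideal R) : Prop :=
  I ≠ ⊤ ∧ ∀ P ∈ associatedPrimes R (R ⧸ I), P.height = 1

variable (R)

/-- `R` satisfies the uniform symbolic topology property on ideals of pure height one, with
multiplier `D`. -/
def HasUSTPPureHeightOne (D : ℕ) : Prop :=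
  0 < D ∧ ∀ q : Ideal R, IsPureHeightOne q → ∀ a : ℕ, 0 < a →
    symbolicPower q (D * a) ≤ q ^ a

/-- The height one primes of `R`, i.e. the prime divisors of `Spec R`. -/
abbrev HeightOnePrime : Type _ := {P : Ideal R // P.IsPrime ∧ P.height = 1}

/-- The relations defining the class group: the subgroup generated by all effective divisors
`a₁ P₁ + ⋯ + a_r P_r` for which `P₁^(a₁) ∩ ⋯ ∩ P_r^(a_r)` is a principal ideal. -/
noncomputable def principalRelations : AddSubgroup (HeightOnePrime R →₀ ℤ) :=
  AddSubgroup.closure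
    {d | ∃ a : HeightOnePrime R →₀ ℕ,
      (⨅ P ∈ a.support, symbolicPower P.1 (a P)).IsPrincipal ∧
        ∀ P, d P = (a P : ℤ)}

/-- The (Weil) divisor class group `Cl(R) = Cl(Spec R)` of a Noetherian normal domain `R`: the free
abelian group on the height one primes modulo `principalRelations`. -/
abbrev DivisorClassGroup : Type _ := (HeightOnePrime R →₀ ℤ) ⧸ principalRelations R

end Algebra

/-! ### Cones and toric rings -/

section Cones

variable {n : ℕ}

/-- The inclusion `ℤⁿ ⊆ ℝⁿ`. -/
def latticeVec (m : Fin n → ℤ) : Fin n → ℝ := fun i => (m i : ℝ)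

/-- `σ = Cone(G)` for a finite set `G` of nonzero vectors of `ℤⁿ`. -/
def IsRationalPolyhedral (σ : PointedCone ℝ (Fin n → ℝ)) : Prop :=
  ∃ G : Set (Fin n → ℤ), G.Finite ∧ 0 ∉ G ∧ σ = PointedCone.hull ℝ (latticeVec '' G)

/-- `σ` contains no line through the origin. -/
def IsStronglyConvex (σ : PointedCone ℝ (Fin n → ℝ)) : Prop :=
  ∀ x ∈ σ, -x ∈ σ → x = 0

/-- `σ` spans `ℝⁿ`, i.e. `dim σ = n`. -/
def IsFull (σ : PointedCone ℝ (Fin n → ℝ)) : Prop :=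
  Submodule.span ℝ (σ : Set (Fin n → ℝ)) = ⊤

/-- `σ = Cone(G)` for some set `G` of vectors of `ℤⁿ` that is linearly independent over `ℝ`
(the case `G = ∅` is `σ = {0}`). -/
def IsSimplicial (σ : PointedCone ℝ (Fin n → ℝ)) : Prop :=
  ∃ G : Set (Fin n → ℤ), LinearIndepOn ℝ latticeVec G ∧
    σ = PointedCone.hull ℝ (latticeVec '' G)

/-- A ray of `σ` is a one-dimensional face. -/
def IsRay (ρ σ : PointedCone ℝ (Fin n → ℝ)) : Prop :=
  ρ.IsFaceOf σ ∧ Module.finrank ℝ (Submodule.span ℝ (ρ : Set (Fin n → ℝ))) = 1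

/-- The primitive ray generators of `σ`: the lattice points with coprime coordinates that lie on
some ray of `σ`. -/
def primitiveRayGenerators (σ : PointedCone ℝ (Fin n → ℝ)) : Set (Fin n → ℤ) :=
  {u | Finset.univ.gcd u = 1 ∧ ∃ ρ : PointedCone ℝ (Fin n → ℝ), IsRay ρ σ ∧ latticeVec u ∈ ρ}

/-- The semigroup `S_σ = σ^∨ ∩ ℤⁿ`, where `σ^∨` is the dual cone of `σ` under the dot product. -/
def dualLatticePoints (σ : PointedCone ℝ (Fin n → ℝ)) : AddSubmonoid (Fin n → ℤ) where
  carrier := {m | ∀ v ∈ σ, 0 ≤ latticeVec m ⬝ᵥ v}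
  zero_mem' := fun v _ => by simp [latticeVec, dotProduct]
  add_mem' := fun {x y} hx hy v hv => by
    have h : latticeVec (x + y) = latticeVec x + latticeVec y := by
      funext i; simp [latticeVec]
    rw [h, add_dotProduct]
    exact add_nonneg (hx v hv) (hy v hv)

/-- The toric ring `k[σ^∨ ∩ ℤⁿ]`, a semigroup ring; its spectrum is `U_σ`. -/
abbrev ToricRing (k : Type*) [Field k] (σ : PointedCone ℝ (Fin n → ℝ)) : Type _ :=
  AddMonoidAlgebra k (dualLatticePoints σ)

/-- The matrix `A_G` whose rows are the primitive ray generators of `σ`, listed in the order `e`. -/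
def rayMatrix (σ : PointedCone ℝ (Fin n → ℝ)) (e : Fin n ≃ primitiveRayGenerators σ) :
    Matrix (Fin n) (Fin n) ℤ :=
  Matrix.of fun i => (e i : Fin n → ℤ)

end Cones

end ToricUSTP

namespace ToricUSTP

/-! ### Symbolic powers and associated primes of quotients. -/

section SymbolicPower

variable {R : Type*} [CommRing R]

/-! Let `M` be the matrix of primitive ray generators. The map `m ↦ M m` identifies the points of
the dual semigroup with the vectors of ℕⁿ that lie in the column lattice of `M`. So the toric ring R
is the degree-zero part of S = k[x₁, …, xₙ], graded by the finite group Q = ℤⁿ / Mℤⁿ of order D =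
|det M| (the Cox ring construction).

The homogeneous elements of S form a factorial monoid H, although a prime of H may factor further in
S through inhomogeneous polynomials. Because every row of `M` is primitive, each degree in Q is
attained outside any given prime of H. These two facts form a `GradedDivisorTheory`, and the rest is
formal. Write I(h) for the ideal of elements of R divisible by h in H. The height one primes of R
are the I(p) with p prime in H, the symbolic power I(p)^(a) is I(p^a) (`symbolicPower_ideal`), and
I(g) is principal exactly when deg g = 0. Hence the degree induces Cl(R) ≅ Q (`ker_divisorDeg`).

For the containment, an ideal of pure height one equals I(g) for some g
(`eq_ideal_of_isPureHeightOne`). Since Q has order D, the power g^D has degree 0, so it is an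
element f of R, and f lies in I(g). An element of the (Da)-th symbolic power is divisible by g^(Da)
= f^a, so it lies in I(g)^a. -/

theorem mem_symbolicPower {I : Ideal R} {a : ℕ} {r : R} :
    r ∈ symbolicPower I a ↔ ∃ s ∈ assComplement I, s * r ∈ I ^ a := by
  rw [symbolicPower, Ideal.mem_comap,
    IsLocalization.algebraMap_mem_map_algebraMap_iff (assComplement I)]

theorem associatedPrimes_quotient_prime [IsNoetherianRing R] {P : Ideal R} (hP : P.IsPrime) :
    associatedPrimes R (R ⧸ P) = {P} := by
  rw [associatedPrimes.eq_singleton_of_isPrimary hP.isPrimary, hP.radical]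

theorem mem_assComplement_prime [IsNoetherianRing R] {P : Ideal R} (hP : P.IsPrime) {s : R} :
    s ∈ assComplement P ↔ s ∉ P := by
  change (∀ P' ∈ associatedPrimes R (R ⧸ P), s ∉ P') ↔ _
  simp [associatedPrimes_quotient_prime hP]

theorem isAssociatedPrime_quotient_iff [IsNoetherianRing R] {I P : Ideal R} :
    P ∈ associatedPrimes R (R ⧸ I) ↔ P.IsPrime ∧ ∃ x : R, ∀ r, r ∈ P ↔ r * x ∈ I := by
  rw [AssociatedPrimes.mem_iff, isAssociatedPrime_iff]
  refine and_congr_right fun _ => ?_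
  rw [(Ideal.Quotient.mk_surjective (I := I)).exists]
  refine exists_congr fun x => ?_
  rw [SetLike.ext_iff]
  refine forall_congr' fun r => ?_
  rw [Submodule.mem_colon_singleton, ← Ideal.Quotient.eq_zero_iff_mem (I := I), map_mul]
  rfl

theorem exists_associatedPrime_of_notMem [IsNoetherianRing R] {I : Ideal R} {x : R} (hx : x ∉ I) :
    ∃ P ∈ associatedPrimes R (R ⧸ I), ∀ r, r * x ∈ I → r ∈ P := by
  obtain ⟨P, hP, hle⟩ := exists_le_isAssociatedPrime_of_isNoetherianRing R
    (Ideal.Quotient.mk I x) (by rwa [Ne, Ideal.Quotient.eq_zero_iff_mem])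
  refine ⟨P, hP, fun r hr => hle ?_⟩
  rw [Submodule.mem_colon_singleton]
  rw [← Ideal.Quotient.eq_zero_iff_mem, map_mul] at hr
  exact hr

end SymbolicPower

/-! ### Graded divisor theories: height one primes and their symbolic powers. -/

/-- A divisor theory on the domain `R` with values in a factorial monoid `H` that is graded by the
group `Q`: the nonzero elements of `R` are the nonzero elements of `H` of degree `0`, and every
degree is attained outside of any given prime of `H`. -/
structure GradedDivisorTheory (R H Q : Type*) [CommRing R] [CommMonoidWithZero H]
    [AddCommGroup Q] where
  /-- The inclusion of `R` in `H`. -/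
  toMonoid : R →*₀ H
  /-- The degree, meaningful on nonzero elements. -/
  deg : H → Q
  injective : Function.Injective toMonoid
  dvd_add : ∀ {h r s}, h ∣ toMonoid r → h ∣ toMonoid s → h ∣ toMonoid (r + s)
  deg_mul : ∀ {a b}, a ≠ 0 → b ≠ 0 → deg (a * b) = deg a + deg b
  deg_eq_zero_iff : ∀ {a}, a ≠ 0 → (deg a = 0 ↔ ∃ r, toMonoid r = a)
  deg_of_isUnit : ∀ {a}, IsUnit a → deg a = 0
  exists_deg : ∀ q, ∃ y, y ≠ 0 ∧ deg y = q
  exists_deg_not_dvd : ∀ {p}, Prime p → ∀ q, ∃ y, ¬ p ∣ y ∧ deg y = q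

namespace GradedDivisorTheory

variable {R H Q : Type*} [CommRing R] [CommMonoidWithZero H] [AddCommGroup Q]
  (T : GradedDivisorTheory R H Q)

/-- The divisorial ideal of `R` attached to an element of the divisor monoid. -/
def ideal (h : H) : Ideal R where
  carrier := {r | h ∣ T.toMonoid r}
  zero_mem' := by simp
  add_mem' := T.dvd_add
  smul_mem' c r hr := by
    rw [smul_eq_mul, Set.mem_ofPred_eq, map_mul]
    exact Dvd.dvd.mul_left hr _

theorem mem_ideal {h : H} {r : R} : r ∈ T.ideal h ↔ h ∣ T.toMonoid r := Iff.rfl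

theorem map_ne_zero {r : R} (hr : r ≠ 0) : T.toMonoid r ≠ 0 := fun h =>
  hr (T.injective (h.trans (map_zero _).symm))

theorem deg_map {r : R} (hr : r ≠ 0) : T.deg (T.toMonoid r) = 0 :=
  (T.deg_eq_zero_iff (T.map_ne_zero hr)).2 ⟨r, rfl⟩

theorem deg_one : T.deg 1 = 0 := T.deg_of_isUnit isUnit_one

theorem nontrivial_monoid (T : GradedDivisorTheory R H Q) : Nontrivial H :=
  let ⟨y, hy, _⟩ := T.exists_deg 0
  ⟨y, 0, hy⟩

theorem nontrivial (T : GradedDivisorTheory R H Q) : Nontrivial R := by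
  have := T.nontrivial_monoid
  refine ⟨1, 0, fun h => ?_⟩
  have := congrArg T.toMonoid h
  simp at this

theorem exists_map_eq {a : H} (ha : a ≠ 0) (h : T.deg a = 0) : ∃ r, r ≠ 0 ∧ T.toMonoid r = a := by
  obtain ⟨r, rfl⟩ := (T.deg_eq_zero_iff ha).1 h
  exact ⟨r, fun h => ha (by rw [h, map_zero]), rfl⟩

theorem ideal_le_ideal {g h : H} (hgh : h ∣ g) : T.ideal g ≤ T.ideal h :=
  fun _ hr => hgh.trans hr

theorem ideal_pow_le (g : H) (m : ℕ) : T.ideal g ^ m ≤ T.ideal (g ^ m) := by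
  induction m with
  | zero => exact fun r _ => by rw [T.mem_ideal, pow_zero]; exact one_dvd _
  | succ m ih =>
    rw [pow_succ, pow_succ, Ideal.mul_le]
    intro x hx y hy
    rw [T.mem_ideal, map_mul]
    exact mul_dvd_mul (ih hx) hy

theorem deg_eq_of_associated {a b : H} (ha : a ≠ 0) (h : Associated a b) :
    T.deg a = T.deg b := by
  have := T.nontrivial_monoid
  obtain ⟨u, rfl⟩ := h
  rw [T.deg_mul ha u.ne_zero, T.deg_of_isUnit u.isUnit, add_zero]

theorem isPrime_ideal {p : H} (hp : Prime p) : (T.ideal p).IsPrime := by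
  refine ⟨fun h => hp.not_isUnit ?_, fun {x y} hxy => ?_⟩
  · have := (Ideal.eq_top_iff_one _).1 h
    rw [T.mem_ideal, map_one] at this
    exact isUnit_of_dvd_one this
  · rw [T.mem_ideal, map_mul] at hxy
    exact hp.dvd_or_dvd hxy

theorem deg_of_map_eq_mul {a b : H} {r : R} (hr : r ≠ 0) (h : T.toMonoid r = a * b) :
    T.deg b = - T.deg a := by
  have h0 := T.map_ne_zero hr
  rw [h] at h0
  have := T.deg_map hr
  rw [h, T.deg_mul (left_ne_zero_of_mul h0) (right_ne_zero_of_mul h0)] at this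
  exact (neg_eq_of_add_eq_zero_right this).symm

theorem map_dvd_map_iff {r s : R} : T.toMonoid r ∣ T.toMonoid s ↔ r ∣ s := by
  refine ⟨fun ⟨t, ht⟩ => ?_, map_dvd _⟩
  by_cases hs : s = 0
  · simp [hs]
  have h0 := T.map_ne_zero hs
  rw [ht] at h0
  have hr : r ≠ 0 := fun h => left_ne_zero_of_mul h0 (by rw [h, map_zero])
  obtain ⟨u, -, rfl⟩ := T.exists_map_eq (right_ne_zero_of_mul h0)
    (by rw [T.deg_of_map_eq_mul hs ht, T.deg_map hr, neg_zero])
  exact ⟨u, T.injective (by rw [ht, map_mul])⟩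

theorem ideal_map (f : R) : T.ideal (T.toMonoid f) = Ideal.span {f} := by
  ext r
  rw [T.mem_ideal, T.map_dvd_map_iff, Ideal.mem_span_singleton]

variable [UniqueFactorizationMonoid H]

theorem isDomain (T : GradedDivisorTheory R H Q) : IsDomain R := by
  have := T.nontrivial
  have : NoZeroDivisors R := ⟨fun {a b} h => by
    by_contra! hc
    have h' : T.toMonoid a * T.toMonoid b = 0 := by rw [← map_mul, h, map_zero]
    rcases mul_eq_zero.1 h' with h' | h'
    · exact T.map_ne_zero hc.1 h'
    · exact T.map_ne_zero hc.2 h'⟩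
  exact NoZeroDivisors.to_isDomain R

theorem deg_pow {a : H} (ha : a ≠ 0) (m : ℕ) : T.deg (a ^ m) = m • T.deg a := by
  have := T.nontrivial_monoid
  induction m with
  | zero => simp [T.deg_one]
  | succ m ih => rw [pow_succ, T.deg_mul (pow_ne_zero _ ha) ha, ih, succ_nsmul]

theorem deg_finset_prod {ι : Type*} (s : Finset ι) (f : ι → H) (hf : ∀ i ∈ s, f i ≠ 0) :
    T.deg (∏ i ∈ s, f i) = ∑ i ∈ s, T.deg (f i) := by
  classical
  have := T.nontrivial_monoid
  induction s using Finset.induction_on with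
  | empty => simp [T.deg_one]
  | insert a s has ih =>
    rw [Finset.prod_insert has, Finset.sum_insert has,
      T.deg_mul (hf a (by simp)) (Finset.prod_ne_zero_iff.2 fun i hi => hf i (by simp [hi])),
      ih fun i hi => hf i (by simp [hi])]

theorem exists_map_eq_mul {a b : H} (ha : a ≠ 0) (hb : b ≠ 0) (h : T.deg a = - T.deg b) :
    ∃ r, r ≠ 0 ∧ T.toMonoid r = a * b :=
  T.exists_map_eq (mul_ne_zero ha hb) (by rw [T.deg_mul ha hb, h, neg_add_cancel])

theorem exists_mem_ideal {g : H} (hg : g ≠ 0) : ∃ r ∈ T.ideal g, r ≠ 0 := by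
  obtain ⟨y, hy, hdeg⟩ := T.exists_deg (- T.deg g)
  obtain ⟨r, hr, h⟩ := T.exists_map_eq_mul hy hg hdeg
  exact ⟨r, ⟨y, by rw [h, mul_comm]⟩, hr⟩

/-- This is the approximation property used throughout: multiplying by a cofactor of degree -deg g
moves g into R without changing its order at p. -/
theorem exists_mul_not_dvd {p : H} (hp : Prime p) {g : H} (hg : g ≠ 0) :
    ∃ r y, r ≠ 0 ∧ T.toMonoid r = g * y ∧ ¬ p ∣ y := by
  obtain ⟨y, hpy, hdeg⟩ := T.exists_deg_not_dvd hp (- T.deg g)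
  have hy : y ≠ 0 := fun h => hpy (h ▸ dvd_zero p)
  obtain ⟨r, hr, h⟩ := T.exists_map_eq_mul hy hg hdeg
  exact ⟨r, y, hr, by rw [h, mul_comm], hpy⟩

theorem ideal_le_ideal_iff {g h : H} (hg : g ≠ 0) (hh : h ≠ 0) :
    T.ideal g ≤ T.ideal h ↔ h ∣ g := by
  refine ⟨fun hle => ?_, T.ideal_le_ideal⟩
  obtain ⟨h', g', c, hrel, rfl, rfl⟩ := UniqueFactorizationMonoid.exists_reduced_factors h hh g
  have hc : c ≠ 0 := left_ne_zero_of_mul hh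
  by_cases hu : IsUnit h'
  · exact mul_dvd_mul_left c hu.dvd
  obtain ⟨p, hp, hph⟩ := WfDvdMonoid.exists_irreducible_factor hu (right_ne_zero_of_mul hh)
  rw [UniqueFactorizationMonoid.irreducible_iff_prime] at hp
  -- A prime p of the reduced denominator h' is refuted by an element of I(g) having no more factors
  -- p than g has.
  obtain ⟨r, y, -, hr, hpy⟩ := T.exists_mul_not_dvd hp hg
  have h1 : c * h' ∣ c * g' * y := by
    rw [← hr]
    exact hle (T.mem_ideal.2 (hr ▸ dvd_mul_right _ _))
  rw [mul_assoc] at h1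
  have h2 : p ∣ g' * y := hph.trans ((mul_dvd_mul_iff_left hc).1 h1)
  exact absurd (hrel hph ((hp.dvd_or_dvd h2).resolve_right hpy)) hp.not_isUnit

/-- Peel off one prime factor at a time: the product of the ideals of p and a lies in the ideal of
their product, hence in P, and P is prime. -/
theorem exists_prime_ideal_le_of_ideal_le {P : Ideal R} (hP : P.IsPrime) (h : H) :
    h ≠ 0 → T.ideal h ≤ P → ∃ p, Prime p ∧ T.ideal p ≤ P := by
  refine UniqueFactorizationMonoid.induction_on_prime h (fun h => absurd rfl h)
    (fun x hx _ hle => absurd ?_ hP.ne_top) fun a p ha hp ih _ hle => ?_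
  · exact (Ideal.eq_top_iff_one _).2 (hle hx.dvd)
  · have : T.ideal p * T.ideal a ≤ P := by
      refine le_trans (Ideal.mul_le.2 fun r hr s hs => ?_) hle
      rw [T.mem_ideal, map_mul]
      exact mul_dvd_mul hr hs
    rcases hP.mul_le.1 this with h | h
    · exact ⟨p, hp, h⟩
    · exact ih ha h

theorem exists_prime_ideal_le {P : Ideal R} (hP : P.IsPrime) (h0 : P ≠ ⊥) :
    ∃ p, Prime p ∧ T.ideal p ≤ P := by
  obtain ⟨f, hf, hf0⟩ := (Submodule.ne_bot_iff _).1 h0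
  refine T.exists_prime_ideal_le_of_ideal_le hP (T.toMonoid f) (T.map_ne_zero hf0) ?_
  rw [T.ideal_map]
  simpa [Ideal.span_le] using hf

theorem ideal_ne_bot {g : H} (hg : g ≠ 0) : T.ideal g ≠ ⊥ := by
  obtain ⟨r, hr, hr0⟩ := T.exists_mem_ideal hg
  exact (Submodule.ne_bot_iff _).2 ⟨r, hr, hr0⟩

theorem height_ideal {p : H} (hp : Prime p) : (T.ideal p).height = 1 := by
  have := T.isDomain
  have := T.isPrime_ideal hp
  refine le_antisymm ?_ (Order.one_le_iff_ne_zero.2 fun h =>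
    T.ideal_ne_bot hp.ne_zero (Ideal.height_eq_zero_iff_eq_bot.1 h))
  have : (T.ideal p).height ≤ (1 : ℕ) := by
    rw [Ideal.height_le_iff]
    intro q hq hlt
    by_cases h0 : q = ⊥
    · subst h0; simp
    · obtain ⟨p', hp', hle⟩ := T.exists_prime_ideal_le hq h0
      have hd := (T.ideal_le_ideal_iff hp'.ne_zero hp.ne_zero).1 (hle.trans hlt.le)
      have hd' := (hp.associated_of_dvd hp' hd).symm.dvd
      exact absurd (T.ideal_le_ideal hd') (hle.trans_lt hlt).not_ge
  simpa using this

theorem exists_prime_of_height_eq_one [IsNoetherianRing R] {P : Ideal R} (hP : P.IsPrime)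
    (h1 : P.height = 1) : ∃ p, Prime p ∧ T.ideal p = P := by
  have := T.isDomain
  obtain ⟨p, hp, hle⟩ := T.exists_prime_ideal_le hP (Ideal.ne_bot_of_height_eq_one h1)
  have := T.isPrime_ideal hp
  exact ⟨p, hp, Ideal.eq_of_le_of_height_le _ hle (by rw [h1, T.height_ideal hp])⟩

theorem symbolicPower_ideal [IsNoetherianRing R] {p : H} (hp : Prime p) (a : ℕ) :
    symbolicPower (T.ideal p) a = T.ideal (p ^ a) := by
  have := T.nontrivial_monoid
  ext r
  rw [mem_symbolicPower]
  constructor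
  · rintro ⟨s, hs, hsr⟩
    rw [mem_assComplement_prime (T.isPrime_ideal hp), T.mem_ideal] at hs
    have := T.ideal_pow_le p a hsr
    rw [T.mem_ideal, map_mul] at this
    exact hp.pow_dvd_of_dvd_mul_left a hs this
  · rintro ⟨h, hr⟩
    by_cases hr0 : r = 0
    · refine ⟨1, one_mem _, ?_⟩
      rw [hr0, mul_zero]
      exact zero_mem _
    have hh : h ≠ 0 := right_ne_zero_of_mul (hr ▸ T.map_ne_zero hr0)
    -- With r = p^a h, take u = pc and s = cb in R, where p divides neither b nor c. Then deg b =
    -- deg p, so b^a h has degree 0 and is some t in R. The identity s^a r = t u^a exhibits r in the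
    -- symbolic power.
    obtain ⟨u, c, hu0, hu, hpc⟩ := T.exists_mul_not_dvd hp hp.ne_zero
    have hc : c ≠ 0 := fun h => hpc (h ▸ dvd_zero p)
    obtain ⟨s, b, hs0, hs, hpb⟩ := T.exists_mul_not_dvd hp hc
    have hb : b ≠ 0 := fun h => hpb (h ▸ dvd_zero p)
    have hbh : T.deg (b ^ a) = - T.deg h := by
      rw [T.deg_of_map_eq_mul hr0 hr, T.deg_pow hb, T.deg_of_map_eq_mul hs0 hs,
        T.deg_of_map_eq_mul hu0 hu, T.deg_pow hp.ne_zero, neg_neg, neg_neg]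
    obtain ⟨t, -, ht⟩ := T.exists_map_eq_mul (pow_ne_zero a hb) hh hbh
    refine ⟨s ^ a, ?_, ?_⟩
    · rw [mem_assComplement_prime (T.isPrime_ideal hp), T.mem_ideal, map_pow, hs]
      intro hd
      exact (hp.dvd_or_dvd (hp.dvd_of_dvd_pow hd)).elim hpc hpb
    · have : s ^ a * r = t * u ^ a := T.injective (by
        simp only [map_mul, map_pow, hr, hs, hu, ht, mul_pow]
        rw [mul_comm (c ^ a), mul_assoc, mul_assoc, mul_comm h, mul_comm (p ^ a) (c ^ a),
          mul_assoc])
      rw [this]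
      exact Ideal.mul_mem_left _ _
        (Ideal.pow_mem_pow ((T.mem_ideal).2 (hu ▸ dvd_mul_right _ _)) a)

theorem isPrincipal_ideal_iff {g : H} (hg : g ≠ 0) :
    (T.ideal g).IsPrincipal ↔ T.deg g = 0 := by
  constructor
  · rintro ⟨f, hf⟩
    have hf0 : f ≠ 0 := by
      rintro rfl
      exact T.ideal_ne_bot hg (by simpa using hf)
    have heq : T.ideal g = T.ideal (T.toMonoid f) := by rw [hf, T.ideal_map]
    have hj := T.map_ne_zero hf0
    have := T.deg_eq_of_associated hg (associated_of_dvd_dvd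
      ((T.ideal_le_ideal_iff hj hg).1 heq.ge) ((T.ideal_le_ideal_iff hg hj).1 heq.le))
    rw [this, T.deg_map hf0]
  · intro h
    obtain ⟨f, -, rfl⟩ := T.exists_map_eq hg h
    exact ⟨f, T.ideal_map f⟩

/-! ### The divisor class group as the group of degrees. -/

section ClassGroup

variable [IsNoetherianRing R]

/-- A prime of the divisor monoid defining the given height one prime. -/
noncomputable def gen (P : HeightOnePrime R) : H :=
  (T.exists_prime_of_height_eq_one P.2.1 P.2.2).choose

theorem prime_gen (P : HeightOnePrime R) : Prime (T.gen P) :=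
  (T.exists_prime_of_height_eq_one P.2.1 P.2.2).choose_spec.1

theorem ideal_gen (P : HeightOnePrime R) : T.ideal (T.gen P) = P.1 :=
  (T.exists_prime_of_height_eq_one P.2.1 P.2.2).choose_spec.2

theorem isRelPrime_gen {P P' : HeightOnePrime R} (h : P ≠ P') :
    IsRelPrime (T.gen P) (T.gen P') := by
  rw [(T.prime_gen P).irreducible.isRelPrime_iff_not_dvd]
  intro hd
  refine h (Subtype.ext ?_)
  rw [← T.ideal_gen, ← T.ideal_gen]
  exact le_antisymm
    (T.ideal_le_ideal ((T.prime_gen P).associated_of_dvd (T.prime_gen P') hd).symm.dvd)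
    (T.ideal_le_ideal hd)

theorem gen_prod_ne_zero (a : HeightOnePrime R →₀ ℕ) :
    ∏ P ∈ a.support, T.gen P ^ a P ≠ 0 := by
  have := T.nontrivial_monoid
  exact Finset.prod_ne_zero_iff.2 fun P _ => pow_ne_zero _ (T.prime_gen P).ne_zero

theorem iInf_symbolicPower (a : HeightOnePrime R →₀ ℕ) :
    ⨅ P ∈ a.support, symbolicPower P.1 (a P) = T.ideal (∏ P ∈ a.support, T.gen P ^ a P) := by
  ext r
  simp only [Submodule.mem_iInf]
  have key : ∀ P : HeightOnePrime R, r ∈ symbolicPower P.1 (a P) ↔ T.gen P ^ a P ∣ T.toMonoid r := by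
    intro P
    rw [← T.ideal_gen, T.symbolicPower_ideal (T.prime_gen P), T.mem_ideal]
  simp only [key]
  constructor
  · intro h
    exact Finset.prod_dvd_of_isRelPrime
      (fun P _ P' _ hne => (T.isRelPrime_gen hne).pow) h
  · intro h P hP
    exact (Finset.dvd_prod_of_mem (fun P => T.gen P ^ a P) hP).trans h

theorem isPrincipal_iInf_symbolicPower (a : HeightOnePrime R →₀ ℕ) :
    (⨅ P ∈ a.support, symbolicPower P.1 (a P)).IsPrincipal ↔
      a.sum (fun P m => m • T.deg (T.gen P)) = 0 := by
  rw [T.iInf_symbolicPower, T.isPrincipal_ideal_iff (T.gen_prod_ne_zero a),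
    T.deg_finset_prod]
  · simp only [T.deg_pow (T.prime_gen _).ne_zero]
    rfl
  · have := T.nontrivial_monoid
    exact fun P _ => pow_ne_zero _ (T.prime_gen P).ne_zero

/-- The degree of a divisor of `R`. -/
noncomputable def divisorDeg : (HeightOnePrime R →₀ ℤ) →+ Q :=
  Finsupp.liftAddHom fun P => zmultiplesHom Q (T.deg (T.gen P))

theorem divisorDeg_single (P : HeightOnePrime R) (m : ℤ) :
    T.divisorDeg (Finsupp.single P m) = m • T.deg (T.gen P) := by
  simp [divisorDeg]

theorem divisorDeg_mapRange (a : HeightOnePrime R →₀ ℕ) :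
    T.divisorDeg (a.mapRange ((↑) : ℕ → ℤ) rfl) = a.sum fun P m => m • T.deg (T.gen P) := by
  simp only [divisorDeg, Finsupp.liftAddHom_apply]
  rw [Finsupp.sum_mapRange_index (fun _ => by simp)]
  simp

theorem divisorDeg_surjective : Function.Surjective T.divisorDeg := by
  have hmem : ∀ y : H, y ≠ 0 → T.deg y ∈ T.divisorDeg.range := by
    intro y
    refine UniqueFactorizationMonoid.induction_on_prime y (fun h => absurd rfl h)
      (fun x hx _ => ?_) fun a p ha hp ih _ => ?_
    · rw [T.deg_of_isUnit hx]; exact zero_mem _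
    · rw [T.deg_mul hp.ne_zero ha]
      refine add_mem ?_ (ih ha)
      let P : HeightOnePrime R := ⟨T.ideal p, T.isPrime_ideal hp, T.height_ideal hp⟩
      refine ⟨Finsupp.single P 1, ?_⟩
      rw [T.divisorDeg_single, one_smul]
      have h := T.ideal_gen P
      exact T.deg_eq_of_associated (T.prime_gen P).ne_zero (associated_of_dvd_dvd
        ((T.ideal_le_ideal_iff hp.ne_zero (T.prime_gen P).ne_zero).1 h.ge)
        ((T.ideal_le_ideal_iff (T.prime_gen P).ne_zero hp.ne_zero).1 h.le))
  intro q
  obtain ⟨y, hy, rfl⟩ := T.exists_deg q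
  exact hmem y hy

theorem mapRange_mem_principalRelations (a : HeightOnePrime R →₀ ℕ)
    (h : T.divisorDeg (a.mapRange ((↑) : ℕ → ℤ) rfl) = 0) :
    a.mapRange ((↑) : ℕ → ℤ) rfl ∈ principalRelations R := by
  refine AddSubgroup.subset_closure ⟨a, ?_, fun P => by simp⟩
  rwa [T.isPrincipal_iInf_symbolicPower, ← T.divisorDeg_mapRange]

theorem ker_divisorDeg [Finite Q] : T.divisorDeg.ker = principalRelations R := by
  apply le_antisymm
  · intro d hd
    have hd : T.divisorDeg d = 0 := hd
    let N : ℕ := Nat.card Q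
    have hN : 1 ≤ N := Nat.card_pos
    let pos : HeightOnePrime R →₀ ℕ := d.mapRange Int.toNat rfl
    let neg : HeightOnePrime R →₀ ℕ := (-d).mapRange Int.toNat rfl
    -- The relations come from effective divisors, while d need not be effective. Adding and
    -- subtracting (N - 1) times the negative part makes the subtracted divisor N • neg, which has
    -- degree 0 because N = |Q|; so both terms are effective of degree 0.
    have hdecomp : d = (pos + (N - 1) • neg).mapRange ((↑) : ℕ → ℤ) rfl -
        (N • neg).mapRange ((↑) : ℕ → ℤ) rfl := by
      ext P
      have := Int.toNat_sub_toNat_neg (d P)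
      simp only [pos, neg, Finsupp.coe_sub, Pi.sub_apply, Finsupp.mapRange_apply,
        Finsupp.coe_add, Finsupp.coe_smul, Pi.add_apply, Pi.smul_apply, smul_eq_mul,
        Finsupp.coe_neg, Pi.neg_apply]
      push_cast [Nat.cast_sub hN]
      linarith
    have h2 : T.divisorDeg ((N • neg).mapRange ((↑) : ℕ → ℤ) rfl) = 0 := by
      have : (N • neg).mapRange ((↑) : ℕ → ℤ) rfl = N • neg.mapRange ((↑) : ℕ → ℤ) rfl := by
        ext P; simp
      rw [this, map_nsmul, card_nsmul_eq_zero']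
    have h1 : T.divisorDeg ((pos + (N - 1) • neg).mapRange ((↑) : ℕ → ℤ) rfl) = 0 := by
      rw [hdecomp, map_sub, h2, sub_zero] at hd
      exact hd
    rw [hdecomp]
    exact sub_mem (T.mapRange_mem_principalRelations _ h1)
      (T.mapRange_mem_principalRelations _ h2)
  · rw [principalRelations, AddSubgroup.closure_le]
    rintro d ⟨a, ha, hd⟩
    have : d = a.mapRange ((↑) : ℕ → ℤ) rfl := by ext P; simp [hd]
    rw [SetLike.mem_coe, AddMonoidHom.mem_ker, this, T.divisorDeg_mapRange]
    exact (T.isPrincipal_iInf_symbolicPower a).1 ha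

/-- The divisor class group is the group of degrees. -/
noncomputable def divisorClassGroupEquiv [Finite Q] : DivisorClassGroup R ≃+ Q :=
  (QuotientAddGroup.quotientAddEquivOfEq T.ker_divisorDeg.symm).trans
    (QuotientAddGroup.quotientKerEquivOfSurjective _ T.divisorDeg_surjective)

end ClassGroup

/-! ### Ideals of pure height one and the uniform containment. -/

/-- Every nonzero ideal has a greatest common divisor in the divisor monoid. -/
theorem exists_gcd {q : Ideal R} (hq : q ≠ ⊥) :
    ∃ g, g ≠ 0 ∧ q ≤ T.ideal g ∧ ∀ p, Prime p → ∃ f ∈ q, ¬ g * p ∣ T.toMonoid f := by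
  obtain ⟨f₀, hf₀, hf₀0⟩ := (Submodule.ne_bot_iff _).1 hq
  -- Choose the common divisor g whose cofactor h in one fixed element f₀ is minimal; if g * p still
  -- divided all of q, then h / p would be smaller.
  obtain ⟨h, ⟨g, hgh, hg⟩, hmin⟩ := (IsWellFounded.wf (r := DvdNotUnit (α := H))).has_min
    {h | ∃ g, g * h = T.toMonoid f₀ ∧ q ≤ T.ideal g}
    ⟨T.toMonoid f₀, 1, one_mul _, fun r _ => by rw [T.mem_ideal]; exact one_dvd _⟩
  have hgh0 : g * h ≠ 0 := hgh ▸ T.map_ne_zero hf₀0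
  have hg0 := left_ne_zero_of_mul hgh0
  refine ⟨g, hg0, hg, fun p hp => ?_⟩
  by_contra! hc
  obtain ⟨h', hh'⟩ : p ∣ h := (mul_dvd_mul_iff_left hg0).1 (hgh ▸ hc f₀ hf₀)
  refine hmin h' ⟨g * p, by rw [mul_assoc, ← hh', hgh], hc⟩ ⟨?_, p, hp.not_isUnit, ?_⟩
  · rintro rfl
    exact hgh0 (by rw [hh', mul_zero, mul_zero])
  · rw [hh', mul_comm]

section PureHeightOne

variable [IsNoetherianRing R]

/-- Take g to be the gcd of q. If some r in I(g) were outside q, an associated prime I(p) would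
contain the colon ideal (q : r). But some f = g f' in q has p ∤ f', and completing f' to s in R away
from p gives f ∣ s r, so s lies in (q : r) but not in I(p). -/
theorem eq_ideal_of_isPureHeightOne {q : Ideal R} (hq : IsPureHeightOne q) :
    ∃ g, g ≠ 0 ∧ q = T.ideal g := by
  have := T.isDomain
  have hbot : q ≠ ⊥ := by
    rintro rfl
    have := hq.2 ⊥ (by rw [associatedPrimes_quotient_prime Ideal.isPrime_bot]; rfl)
    simp at this
  obtain ⟨g, hg0, hle, hg⟩ := T.exists_gcd hbot
  refine ⟨g, hg0, le_antisymm hle fun r hr => ?_⟩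
  by_contra hrq
  obtain ⟨P, hP, hcolon⟩ := exists_associatedPrime_of_notMem hrq
  have hPp : P.IsPrime := hP.isPrime
  obtain ⟨p, hp, rfl⟩ := T.exists_prime_of_height_eq_one hPp (hq.2 P hP)
  obtain ⟨f, hf, hpf⟩ := hg p hp
  obtain ⟨f', hf'⟩ := hle hf
  have hpf' : ¬ p ∣ f' := fun h => hpf (hf' ▸ mul_dvd_mul_left g h)
  have hf0 : f ≠ 0 := fun h => hpf (by rw [h, map_zero]; exact dvd_zero _)
  have hf'0 : f' ≠ 0 := fun h => hpf' (h ▸ dvd_zero p)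
  obtain ⟨s, y, hs0, hs, hpy⟩ := T.exists_mul_not_dvd hp hf'0
  have hsP : s ∉ T.ideal p := by
    rw [T.mem_ideal, hs]
    exact fun h => (hp.dvd_or_dvd h).elim hpf' hpy
  refine hsP (hcolon s ?_)
  have hfr : f ∣ s * r := by
    obtain ⟨h, hh⟩ := hr
    rw [← T.map_dvd_map_iff, map_mul, hs, hh, hf']
    exact ⟨y * h, by ac_rfl⟩
  exact Ideal.mem_of_dvd _ hfr hf

theorem ideal_mem_associatedPrimes {g p : H} (hg : g ≠ 0) (hp : Prime p) (hpg : p ∣ g) :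
    T.ideal p ∈ associatedPrimes R (R ⧸ T.ideal g) := by
  obtain ⟨g', rfl⟩ := hpg
  have hg' := right_ne_zero_of_mul hg
  obtain ⟨x, y, hx0, hx, hpy⟩ := T.exists_mul_not_dvd hp hg'
  refine isAssociatedPrime_quotient_iff.2 ⟨T.isPrime_ideal hp, x, fun r => ?_⟩
  rw [T.mem_ideal, T.mem_ideal, map_mul, hx, mul_left_comm, mul_comm p g',
    mul_dvd_mul_iff_left hg']
  exact ⟨fun h => h.mul_right y, fun h => (hp.dvd_or_dvd h).resolve_right hpy⟩

theorem hasUSTPPureHeightOne (T : GradedDivisorTheory R H Q) [Finite Q] :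
    HasUSTPPureHeightOne R (Nat.card Q) := by
  have := T.nontrivial_monoid
  have := T.nontrivial
  refine ⟨Nat.card_pos, fun q hq a ha r hr => ?_⟩
  obtain ⟨g, hg0, rfl⟩ := T.eq_ideal_of_isPureHeightOne hq
  -- The multiplier arises here: |Q| annihilates deg g, so g ^ |Q| is an element of R.
  obtain ⟨f, hf0, hf⟩ := T.exists_map_eq (pow_ne_zero (Nat.card Q) hg0)
    (by rw [T.deg_pow hg0, card_nsmul_eq_zero'])
  obtain ⟨s, hs, hsr⟩ := mem_symbolicPower.1 hr
  have hdvd : g ^ (Nat.card Q * a) ∣ T.toMonoid s * T.toMonoid r := by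
    rw [← map_mul]; exact T.ideal_pow_le g _ hsr
  -- Each prime factor of g gives an associated prime, which s avoids.
  have hrel : IsRelPrime (g ^ (Nat.card Q * a)) (T.toMonoid s) := by
    refine IsRelPrime.pow_left ?_
    rw [UniqueFactorizationMonoid.isRelPrime_iff_no_prime_factors hg0]
    intro p hpg hps hp
    exact hs _ (T.ideal_mem_associatedPrimes hg0 hp hpg) hps
  have hfr : f ^ a ∣ r := by
    rw [← T.map_dvd_map_iff, map_pow, hf, ← pow_mul]
    exact hrel.dvd_of_dvd_mul_left hdvd
  have hfg : f ∈ T.ideal g := by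
    rw [T.mem_ideal, hf]
    exact dvd_pow_self g Nat.card_pos.ne'
  exact Ideal.mem_of_dvd _ hfr (Ideal.pow_mem_pow hfg a)

end PureHeightOne

end GradedDivisorTheory


/-! ### Factoriality of the monoid of homogeneous polynomials. -/

section WeightedHomogeneous

open MvPolynomial

variable {k τ Q : Type*} [Field k] [AddCommGroup Q] {w : τ → Q}

attribute [local instance] MvPolynomial.weightedGradedAlgebra in
theorem weightedHomogeneousComponent_mul {f : MvPolynomial τ k} {q : Q}
    (hf : IsWeightedHomogeneous w f q) (h : MvPolynomial τ k) (s : Q) :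
    weightedHomogeneousComponent w (q + s) (f * h) = f * weightedHomogeneousComponent w s h := by
  classical
  simp_rw [← weightedDecomposition.decompose'_apply]
  exact DirectSum.coe_decompose_mul_add_of_left_mem (weightedHomogeneousSubmodule k w) hf

theorem weightedHomogeneousComponent_mul' {f : MvPolynomial τ k} {q : Q}
    (hf : IsWeightedHomogeneous w f q) (h : MvPolynomial τ k) (s : Q) :
    weightedHomogeneousComponent w s (f * h) =
      f * weightedHomogeneousComponent w (s - q) h := by
  rw [← weightedHomogeneousComponent_mul hf, add_sub_cancel]

theorem isWeightedHomogeneous_of_mul {f g : MvPolynomial τ k} {q q' : Q} (hf0 : f ≠ 0)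
    (hf : IsWeightedHomogeneous w f q) (hfg : IsWeightedHomogeneous w (f * g) q') :
    IsWeightedHomogeneous w g (q' - q) := by
  have h := weightedHomogeneousComponent_mul' hf g q'
  rw [hfg.weightedHomogeneousComponent_same] at h
  rw [mul_left_cancel₀ hf0 h]
  exact weightedHomogeneousComponent_mem w _ _

/-- A generator of a homogeneous principal ideal is homogeneous: a nonzero component of m is a
multiple of m of no larger total degree, hence a constant multiple of m. -/
theorem isWeightedHomogeneous_of_forall_dvd {m : MvPolynomial τ k}
    (hm : ∀ s, m ∣ weightedHomogeneousComponent w s m) : ∃ q, IsWeightedHomogeneous w m q := by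
  classical
  by_cases hm0 : m = 0
  · exact ⟨0, hm0 ▸ isWeightedHomogeneous_zero k w 0⟩
  obtain ⟨d, hd⟩ := MvPolynomial.support_nonempty.2 hm0
  have hne : weightedHomogeneousComponent w (Finsupp.weight w d) m ≠ 0 := fun h => by
    have := congrArg (coeff d) h
    rw [coeff_weightedHomogeneousComponent, if_pos rfl, coeff_zero] at this
    exact (mem_support_iff.1 hd) this
  obtain ⟨a, ha⟩ := hm (Finsupp.weight w d)
  have ha0 : a ≠ 0 := right_ne_zero_of_mul (ha ▸ hne)
  have hle : (weightedHomogeneousComponent w (Finsupp.weight w d) m).totalDegree ≤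
      m.totalDegree := by
    refine Finset.sup_mono ?_
    rw [support_weightedHomogeneousComponent]
    exact Finset.filter_subset _ _
  rw [ha, totalDegree_mul_of_isDomain hm0 ha0] at hle
  obtain ⟨c, rfl⟩ : ∃ c, a = C c := ⟨_, (totalDegree_eq_zero_iff_eq_C.1 (by omega))⟩
  refine ⟨0 + Finsupp.weight w d, ?_⟩
  have hc : c ≠ 0 := fun h => ha0 (by rw [h, C_0])
  have : m = C c⁻¹ * weightedHomogeneousComponent w (Finsupp.weight w d) m := by
    rw [ha, mul_left_comm, ← C_mul, inv_mul_cancel₀ hc, C_1, mul_one]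
  rw [this]
  exact (isWeightedHomogeneous_C w _).mul
    (weightedHomogeneousComponent_mem w _ _)

variable (k w)

/-- The multiplicative monoid of weighted homogeneous polynomials, zero included. -/
noncomputable def homogeneousMonoid : Submonoid (MvPolynomial τ k) where
  carrier := {f | ∃ q, IsWeightedHomogeneous w f q}
  one_mem' := ⟨0, isWeightedHomogeneous_one k w⟩
  mul_mem' := fun ⟨_, ha⟩ ⟨_, hb⟩ => ⟨_, ha.mul hb⟩

variable {k w}

noncomputable instance : CommMonoidWithZero (homogeneousMonoid k w) where
  zero := ⟨0, 0, isWeightedHomogeneous_zero k w 0⟩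
  zero_mul _ := Subtype.ext (zero_mul _)
  mul_zero _ := Subtype.ext (mul_zero _)

@[simp]
theorem coe_zero : ((0 : homogeneousMonoid k w) : MvPolynomial τ k) = 0 := rfl

theorem coe_eq_zero {a : homogeneousMonoid k w} : (a : MvPolynomial τ k) = 0 ↔ a = 0 :=
  ⟨fun h => Subtype.ext h, fun h => h ▸ rfl⟩

theorem coe_dvd_coe {a b : homogeneousMonoid k w} :
    (a : MvPolynomial τ k) ∣ b ↔ a ∣ b := by
  refine ⟨fun ⟨c, hc⟩ => ?_, fun ⟨c, hc⟩ => ⟨c, by rw [hc]; rfl⟩⟩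
  by_cases ha : a = 0
  · have : b = 0 := coe_eq_zero.1 (by rw [hc, ha, coe_zero, zero_mul])
    rw [ha, this]
  obtain ⟨q, hq⟩ := a.2
  obtain ⟨q', hq'⟩ := b.2
  exact ⟨⟨c, _, isWeightedHomogeneous_of_mul (mt coe_eq_zero.1 ha) hq (hc ▸ hq')⟩, Subtype.ext hc⟩

theorem isUnit_coe {a : homogeneousMonoid k w} : IsUnit (a : MvPolynomial τ k) ↔ IsUnit a := by
  rw [isUnit_iff_dvd_one, isUnit_iff_dvd_one, ← coe_dvd_coe]
  rfl

instance : Nontrivial (homogeneousMonoid k w) :=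
  ⟨1, 0, fun h => one_ne_zero (α := MvPolynomial τ k) (congrArg Subtype.val h)⟩

instance : IsCancelMulZero (homogeneousMonoid k w) :=
  Function.Injective.isCancelMulZero Subtype.val Subtype.val_injective rfl fun _ _ => rfl

theorem dvdNotUnit_coe {a b : homogeneousMonoid k w} (h : DvdNotUnit a b) :
    DvdNotUnit (a : MvPolynomial τ k) b := by
  obtain ⟨h0, c, hc, rfl⟩ := h
  exact ⟨mt coe_eq_zero.1 h0, c, mt isUnit_coe.1 hc, rfl⟩

/-- In the polynomial ring, write p = c m with c a gcd of p and a. The colon ideal (p : a) is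
generated by m, and it is homogeneous because p and a are. So m and c are homogeneous, and
irreducibility of p in the monoid makes one of them a unit. -/
theorem homogeneousMonoid.prime_of_irreducible [Finite τ] {p : homogeneousMonoid k w}
    (hp : Irreducible p) : Prime p := by
  have hp0 : (p : MvPolynomial τ k) ≠ 0 := mt coe_eq_zero.1 hp.ne_zero
  refine ⟨hp.ne_zero, hp.not_isUnit, fun a b hab => ?_⟩
  by_cases ha0 : a = 0
  · exact Or.inl (ha0 ▸ dvd_zero p)
  obtain ⟨m, a', c, hrel, hcm, hca⟩ :=
    UniqueFactorizationMonoid.exists_reduced_factors (p : MvPolynomial τ k) hp0 a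
  have hc0 : c ≠ 0 := left_ne_zero_of_mul (hcm ▸ hp0)
  have hm0 : m ≠ 0 := right_ne_zero_of_mul (hcm ▸ hp0)
  have key : ∀ h, (p : MvPolynomial τ k) ∣ a * h ↔ m ∣ h := by
    intro h
    rw [← hcm, ← hca, mul_assoc, mul_dvd_mul_iff_left hc0]
    exact ⟨hrel.dvd_of_dvd_mul_left, fun h => h.mul_left _⟩
  obtain ⟨qp, hqp⟩ := p.2
  obtain ⟨qa, hqa⟩ := a.2
  obtain ⟨qm, hqm⟩ : ∃ q, IsWeightedHomogeneous w m q := by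
    refine isWeightedHomogeneous_of_forall_dvd fun s => (key _).1 ?_
    obtain ⟨h, hh⟩ := (key m).2 dvd_rfl
    rw [← weightedHomogeneousComponent_mul hqa, hh, weightedHomogeneousComponent_mul' hqp]
    exact dvd_mul_right _ _
  have hqc := isWeightedHomogeneous_of_mul hm0 hqm (by rw [mul_comm, hcm]; exact hqp)
  have hpeq : p = ⟨c, _, hqc⟩ * ⟨m, _, hqm⟩ := Subtype.ext hcm.symm
  rcases hp.isUnit_or_isUnit hpeq with h | h
  · right
    rw [← coe_dvd_coe, ← hcm, (isUnit_coe.2 h).mul_left_dvd]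
    exact (key _).1 (coe_dvd_coe.2 hab)
  · left
    rw [← coe_dvd_coe, ← hcm, (isUnit_coe.2 h).mul_right_dvd]
    exact hca ▸ dvd_mul_right _ _

instance [Finite τ] : UniqueFactorizationMonoid (homogeneousMonoid k w) where
  wf := Subrelation.wf (fun h => dvdNotUnit_coe h)
    (InvImage.wf Subtype.val (IsWellFounded.wf (r := DvdNotUnit (α := MvPolynomial τ k))))
  irreducible_iff_prime := ⟨homogeneousMonoid.prime_of_irreducible, Prime.irreducible⟩

namespace homogeneousMonoid

/-- The weight of a nonzero homogeneous polynomial. -/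
noncomputable def deg (a : homogeneousMonoid k w) : Q := a.2.choose

theorem isWeightedHomogeneous_deg (a : homogeneousMonoid k w) :
    IsWeightedHomogeneous w (a : MvPolynomial τ k) (deg a) := a.2.choose_spec

theorem deg_eq {a : homogeneousMonoid k w} (ha : a ≠ 0) {q : Q}
    (h : IsWeightedHomogeneous w (a : MvPolynomial τ k) q) : deg a = q :=
  (isWeightedHomogeneous_deg a).inj_right (mt coe_eq_zero.1 ha) h

/-- A monomial as a homogeneous polynomial. -/
noncomputable def monom (c : τ →₀ ℕ) : homogeneousMonoid k w :=
  ⟨monomial c 1, _, isWeightedHomogeneous_monomial w c 1 rfl⟩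

theorem monom_ne_zero (c : τ →₀ ℕ) : (monom c : homogeneousMonoid k w) ≠ 0 := by
  rw [← coe_eq_zero.ne]
  simp [monom]

theorem deg_monom (c : τ →₀ ℕ) : deg (monom c : homogeneousMonoid k w) = Finsupp.weight w c :=
  deg_eq (monom_ne_zero c) (isWeightedHomogeneous_monomial w c 1 rfl)

theorem exists_dvd_X_of_dvd_monom {p : homogeneousMonoid k w} (hp : Prime p) (c : τ →₀ ℕ)
    (h : p ∣ monom c) : ∃ i, c i ≠ 0 ∧ (p : MvPolynomial τ k) ∣ X i := by
  classical
  induction c using Finsupp.induction_linear with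
  | zero => exact absurd (isUnit_of_dvd_one h) hp.not_isUnit
  | add a b iha ihb =>
    have : (monom (a + b) : homogeneousMonoid k w) = monom a * monom b :=
      Subtype.ext (by simp [monom, monomial_mul])
    rw [this] at h
    rcases hp.dvd_or_dvd h with h | h
    · obtain ⟨i, hi, hd⟩ := iha h
      exact ⟨i, by simp [hi], hd⟩
    · obtain ⟨i, hi, hd⟩ := ihb h
      exact ⟨i, by simp [hi], hd⟩
  | single i m =>
    have : (monom (Finsupp.single i m) : homogeneousMonoid k w) =
        ⟨X i, _, isWeightedHomogeneous_X k w i⟩ ^ m :=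
      Subtype.ext (by simp [monom, X_pow_eq_monomial])
    rw [this] at h
    refine ⟨i, ?_, coe_dvd_coe.2 (hp.dvd_of_dvd_pow h)⟩
    rintro hm
    rw [Finsupp.single_eq_same] at hm
    rw [hm, pow_zero] at h
    exact hp.not_isUnit (isUnit_of_dvd_one h)

theorem exists_not_dvd_monom {p : homogeneousMonoid k w} (hp : Prime p)
    (hw : ∀ q, ∃ c : τ →₀ ℕ, Finsupp.weight w c = q)
    (hw' : ∀ i q, ∃ c : τ →₀ ℕ, c i = 0 ∧ Finsupp.weight w c = q) (q : Q) :
    ∃ c : τ →₀ ℕ, ¬ p ∣ monom c ∧ Finsupp.weight w c = q := by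
  by_cases h : ∃ i, (p : MvPolynomial τ k) ∣ X i
  · obtain ⟨i, hi⟩ := h
    obtain ⟨c, hci, hc⟩ := hw' i q
    refine ⟨c, fun hd => ?_, hc⟩
    obtain ⟨l, hl, hpl⟩ := exists_dvd_X_of_dvd_monom hp c hd
    have hpu : ¬ IsUnit (p : MvPolynomial τ k) := mt isUnit_coe.1 hp.not_isUnit
    -- A nonunit divisor of the irreducible `X i` is associated to it, so p divides only this
    -- variable.
    have hil : (X i : MvPolynomial τ k) ∣ X l :=
      (((X_prime (R := k) (i := i)).irreducible.dvd_iff.1 hi).resolve_left hpu).dvd.trans hpl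
    rw [X_dvd_X] at hil
    exact hl (hil ▸ hci)
  · push Not at h
    obtain ⟨c, hc⟩ := hw q
    exact ⟨c, fun hd => let ⟨i, _, hi⟩ := exists_dvd_X_of_dvd_monom hp c hd; h i hi, hc⟩

end homogeneousMonoid

/-! ### The weight-zero subring: divisor theory and Noetherianity. -/

section DegreeZero

variable {R : Type*} [CommRing R] (ι : R →+* MvPolynomial τ k)

/-- A ring that is the part of weight zero of a polynomial ring has a divisor theory with values
in the homogeneous polynomials. -/
noncomputable def weightZeroDivisorTheory (hinj : Function.Injective ι)
    (hι : ∀ f, IsWeightedHomogeneous w f 0 ↔ ∃ r, ι r = f)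
    (hw : ∀ q, ∃ c : τ →₀ ℕ, Finsupp.weight w c = q)
    (hw' : ∀ i q, ∃ c : τ →₀ ℕ, c i = 0 ∧ Finsupp.weight w c = q) :
    GradedDivisorTheory R (homogeneousMonoid k w) Q where
  toMonoid :=
    { toFun := fun r => ⟨ι r, 0, (hι _).2 ⟨r, rfl⟩⟩
      map_zero' := Subtype.ext (map_zero ι)
      map_one' := Subtype.ext (map_one ι)
      map_mul' := fun a b => Subtype.ext (map_mul ι a b) }
  deg := homogeneousMonoid.deg
  injective := fun a b h => hinj (congrArg Subtype.val h)
  dvd_add := fun {h r s} hr hs => by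
    rw [← coe_dvd_coe] at hr hs ⊢
    have := dvd_add hr hs
    simpa using this
  deg_mul := fun {a b} ha hb => homogeneousMonoid.deg_eq (mul_ne_zero ha hb)
    ((homogeneousMonoid.isWeightedHomogeneous_deg a).mul
      (homogeneousMonoid.isWeightedHomogeneous_deg b))
  deg_eq_zero_iff := fun {a} ha => by
    constructor
    · intro h
      obtain ⟨r, hr⟩ := (hι a).1 (h ▸ homogeneousMonoid.isWeightedHomogeneous_deg a)
      exact ⟨r, Subtype.ext hr⟩
    · rintro ⟨r, rfl⟩
      exact homogeneousMonoid.deg_eq ha ((hι _).2 ⟨r, rfl⟩)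
  deg_of_isUnit := fun {a} ha => by
    refine homogeneousMonoid.deg_eq ha.ne_zero ?_
    obtain ⟨c, -, hc⟩ := MvPolynomial.isUnit_iff_eq_C_of_isReduced.1 (isUnit_coe.2 ha)
    rw [hc]
    exact isWeightedHomogeneous_C w c
  exists_deg := fun q =>
    let ⟨c, hc⟩ := hw q
    ⟨_, homogeneousMonoid.monom_ne_zero c, (homogeneousMonoid.deg_monom c).trans hc⟩
  exists_deg_not_dvd := fun hp q =>
    let ⟨c, hpc, hc⟩ := homogeneousMonoid.exists_not_dvd_monom hp hw hw' q
    ⟨_, hpc, (homogeneousMonoid.deg_monom c).trans hc⟩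

/-- Hilbert's argument: projection to weight zero is R-linear, so extending an ideal to the
polynomial ring and contracting gives it back. Ascending chains therefore stabilize as they do in
the polynomial ring. -/
theorem isNoetherianRing_of_weight_zero [Finite τ] (hinj : Function.Injective ι)
    (hι : ∀ f, IsWeightedHomogeneous w f 0 ↔ ∃ r, ι r = f) : IsNoetherianRing R := by
  have key : ∀ (I : Ideal R), ∀ x ∈ I.map ι, ∀ a,
      ∃ r ∈ I, ι r = weightedHomogeneousComponent w 0 (a * x) := by
    intro I x hx
    refine Submodule.span_induction ?_ ?_ ?_ ?_ hx
    · rintro _ ⟨r, hr, rfl⟩ a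
      obtain ⟨s, hs⟩ := (hι _).1
        (weightedHomogeneousComponent_mem w a 0)
      refine ⟨r * s, I.mul_mem_right _ hr, ?_⟩
      rw [mul_comm a, weightedHomogeneousComponent_mul' ((hι _).2 ⟨r, rfl⟩), sub_zero, map_mul,
        hs]
    · exact fun a => ⟨0, zero_mem _, by simp⟩
    · intro x y _ _ hx hy a
      obtain ⟨r, hr, hr'⟩ := hx a
      obtain ⟨s, hs, hs'⟩ := hy a
      exact ⟨r + s, add_mem hr hs, by rw [map_add, hr', hs', mul_add, map_add]⟩
    · intro b x _ hx a
      obtain ⟨r, hr, hr'⟩ := hx (a * b)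
      exact ⟨r, hr, by rw [hr', smul_eq_mul, mul_assoc]⟩
  have hle : ∀ I J : Ideal R, I.map ι ≤ J.map ι → I ≤ J := by
    intro I J h r hr
    obtain ⟨s, hs, hs'⟩ := key J _ (h (Ideal.mem_map_of_mem ι hr)) 1
    rw [one_mul, ((hι _).2 ⟨r, rfl⟩ :
      IsWeightedHomogeneous w (ι r) 0).weightedHomogeneousComponent_same] at hs'
    exact hinj hs' ▸ hs
  have hmono : StrictMono (Ideal.map ι) := fun I J h =>
    lt_of_le_not_ge (Ideal.map_mono h.le) fun h' => h.not_ge (hle _ _ h')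
  rw [isNoetherianRing_iff, isNoetherian_iff']
  exact hmono.wellFoundedGT

end DegreeZero

end WeightedHomogeneous


/-! ### The grading group ℤⁿ / Mℤⁿ and the total coordinate ring. -/

section Lattice

open Matrix MvPolynomial

variable {n : ℕ}

/-- The quotient of `ℤⁿ` by the column lattice of `M`. -/
abbrev ColumnQuotient (M : Matrix (Fin n) (Fin n) ℤ) : Type :=
  (Fin n → ℤ) ⧸ LinearMap.range (toLin' M)

/-- The class of the `i`-th unit vector modulo the column lattice. -/
def unitClass (M : Matrix (Fin n) (Fin n) ℤ) (i : Fin n) : ColumnQuotient M :=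
  Submodule.Quotient.mk (Pi.single i 1)

theorem mulVec_injective_of_det_ne_zero {M : Matrix (Fin n) (Fin n) ℤ} (hM : M.det ≠ 0) :
    Function.Injective M.mulVec := by
  have h : Function.Injective (toLin' M) := by
    rw [← LinearMap.ker_eq_bot, LinearMap.ker_eq_bot']
    intro m hm
    exact Matrix.eq_zero_of_mulVec_eq_zero hM hm
  exact h

theorem card_columnQuotient {M : Matrix (Fin n) (Fin n) ℤ} (hM : M.det ≠ 0) :
    Nat.card (ColumnQuotient M) = M.det.natAbs := by
  have hinj : Function.Injective (toLin' M) := mulVec_injective_of_det_ne_zero hM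
  rw [← Submodule.natAbs_det_equiv (LinearMap.range (toLin' M))
    (LinearEquiv.ofInjective (toLin' M) hinj), ← LinearMap.det_toLin']
  rfl

theorem finite_columnQuotient {M : Matrix (Fin n) (Fin n) ℤ} (hM : M.det ≠ 0) :
    Finite (ColumnQuotient M) :=
  Nat.finite_of_card_ne_zero (by rwa [card_columnQuotient hM, Int.natAbs_ne_zero])

theorem weight_unitClass (M : Matrix (Fin n) (Fin n) ℤ) (c : Fin n →₀ ℕ) :
    Finsupp.weight (unitClass M) c = Submodule.Quotient.mk fun i => (c i : ℤ) := by
  have h : (fun i => (c i : ℤ)) = ∑ i, c i • (Pi.single i 1 : Fin n → ℤ) := by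
    ext l
    simp [Finset.sum_apply, Pi.single_apply]
  rw [Finsupp.weight_apply, Finsupp.sum_fintype _ _ (by simp), h,
    ← Submodule.mkQ_apply, map_sum]
  simp only [map_nsmul]
  rfl

theorem exists_weight_eq_mk {M : Matrix (Fin n) (Fin n) ℤ} (hM : M.det ≠ 0) (z : Fin n → ℤ) :
    ∃ c : Fin n →₀ ℕ, (∀ i, z i = 0 → c i = 0) ∧
      Finsupp.weight (unitClass M) c = Submodule.Quotient.mk z := by
  have := finite_columnQuotient hM
  let N : ℕ := Nat.card (ColumnQuotient M)
  have hN : (N : ℤ) ≠ 0 := by exact_mod_cast Nat.card_pos.ne'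
  -- The order N of the quotient kills it, so reducing coordinates mod N keeps the class, makes them
  -- nonnegative and preserves zeros.
  refine ⟨Finsupp.equivFunOnFinite.symm fun i => (z i % N).toNat, fun i hi => by simp [hi], ?_⟩
  rw [weight_unitClass, ← sub_eq_zero, ← Submodule.Quotient.mk_sub]
  have : (fun i => ((Finsupp.equivFunOnFinite.symm (fun i => (z i % N).toNat) i : ℕ) : ℤ)) - z =
      N • fun i => - (z i / N) := by
    ext i
    have h := Int.emod_nonneg (z i) hN
    have h' := Int.emod_add_mul_ediv (z i) N
    simp only [Pi.sub_apply, Finsupp.equivFunOnFinite_symm_apply_apply, Int.toNat_of_nonneg h,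
      Pi.smul_apply, nsmul_eq_mul]
    linarith
  rw [this]
  exact card_nsmul_eq_zero' (G := ColumnQuotient M) (x := Submodule.Quotient.mk _)

theorem exists_weight_eq {M : Matrix (Fin n) (Fin n) ℤ} (hM : M.det ≠ 0)
    (q : ColumnQuotient M) : ∃ c : Fin n →₀ ℕ, Finsupp.weight (unitClass M) c = q := by
  obtain ⟨z, rfl⟩ := Submodule.Quotient.mk_surjective _ q
  obtain ⟨c, -, hc⟩ := exists_weight_eq_mk hM z
  exact ⟨c, hc⟩

theorem exists_weight_eq_of_gcd_row_eq_one {M : Matrix (Fin n) (Fin n) ℤ} (hM : M.det ≠ 0)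
    (i : Fin n) (hi : Finset.univ.gcd (M i) = 1) (q : ColumnQuotient M) :
    ∃ c : Fin n →₀ ℕ, c i = 0 ∧ Finsupp.weight (unitClass M) c = q := by
  obtain ⟨z, rfl⟩ := Submodule.Quotient.mk_surjective _ q
  obtain ⟨u, hu⟩ := Finset.gcd_eq_sum_mul Finset.univ (M i)
  have hu' : (M *ᵥ u) i = 1 := by rw [← hi, hu]; rfl
  -- By Bézout, the lattice vector M u has i-th coordinate 1; subtracting a multiple of it clears
  -- coordinate i within the same class.
  obtain ⟨c, hci, hc⟩ := exists_weight_eq_mk hM (z - z i • (M *ᵥ u))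
  refine ⟨c, hci i (by simp [hu']), hc.trans ?_⟩
  rw [Submodule.Quotient.eq, sub_sub_cancel_left]
  exact neg_mem (Submodule.smul_mem _ _ ⟨u, rfl⟩)

variable (k : Type*) [Field k] {σ : PointedCone ℝ (Fin n → ℝ)} {M : Matrix (Fin n) (Fin n) ℤ}

/-- The values of the rows of `M` on the points of the dual semigroup. -/
noncomputable def dualExponent (hS : ∀ m, m ∈ dualLatticePoints σ ↔ ∀ i, 0 ≤ (M *ᵥ m) i) :
    dualLatticePoints σ →+ (Fin n →₀ ℕ) where
  toFun m := Finsupp.equivFunOnFinite.symm fun i => ((M *ᵥ (m : Fin n → ℤ)) i).toNat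
  map_zero' := by ext i; simp
  map_add' a b := by
    ext i
    simp [mulVec_add, Int.toNat_add ((hS a).1 a.2 i) ((hS b).1 b.2 i)]

theorem coe_dualExponent (hS : ∀ m, m ∈ dualLatticePoints σ ↔ ∀ i, 0 ≤ (M *ᵥ m) i)
    (m : dualLatticePoints σ) :
    (fun i => (dualExponent hS m i : ℤ)) = M *ᵥ (m : Fin n → ℤ) := by
  ext i
  exact Int.toNat_of_nonneg ((hS m).1 m.2 i)

theorem dualExponent_injective (hS : ∀ m, m ∈ dualLatticePoints σ ↔ ∀ i, 0 ≤ (M *ᵥ m) i)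
    (hM : M.det ≠ 0) : Function.Injective (dualExponent hS) := fun a b h => by
  refine Subtype.ext (mulVec_injective_of_det_ne_zero hM ?_)
  rw [← coe_dualExponent hS, ← coe_dualExponent hS, h]

theorem weight_unitClass_eq_zero_iff
    (hS : ∀ m, m ∈ dualLatticePoints σ ↔ ∀ i, 0 ≤ (M *ᵥ m) i) (c : Fin n →₀ ℕ) :
    Finsupp.weight (unitClass M) c = 0 ↔ ∃ m, dualExponent hS m = c := by
  rw [weight_unitClass, Submodule.Quotient.mk_eq_zero]
  constructor
  · rintro ⟨m, hm⟩
    rw [toLin'_apply] at hm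
    have hmem : m ∈ dualLatticePoints σ :=
      (hS m).2 fun i => by rw [hm]; exact Int.natCast_nonneg _
    refine ⟨⟨m, hmem⟩, ?_⟩
    ext i
    have := congrFun ((coe_dualExponent hS ⟨m, hmem⟩).trans hm) i
    exact_mod_cast this
  · rintro ⟨m, rfl⟩
    exact ⟨m, (coe_dualExponent hS m).symm⟩

/-- The embedding of the toric ring of a simplicial cone in its total coordinate ring. -/
noncomputable def toCoordinateRing (hS : ∀ m, m ∈ dualLatticePoints σ ↔ ∀ i, 0 ≤ (M *ᵥ m) i) :
    ToricRing k σ →+* MvPolynomial (Fin n) k :=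
  AddMonoidAlgebra.mapDomainRingHom k (dualExponent hS)

theorem toCoordinateRing_single (hS : ∀ m, m ∈ dualLatticePoints σ ↔ ∀ i, 0 ≤ (M *ᵥ m) i)
    (m : dualLatticePoints σ) (c : k) :
    toCoordinateRing k hS (AddMonoidAlgebra.single m c) = monomial (dualExponent hS m) c := by
  rw [toCoordinateRing, AddMonoidAlgebra.mapDomainRingHom_apply, AddMonoidAlgebra.mapDomain_single,
    MvPolynomial.single_eq_monomial]

theorem toCoordinateRing_injective
    (hS : ∀ m, m ∈ dualLatticePoints σ ↔ ∀ i, 0 ≤ (M *ᵥ m) i) (hM : M.det ≠ 0) :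
    Function.Injective (toCoordinateRing k hS) :=
  AddMonoidAlgebra.mapDomain_injective (dualExponent_injective hS hM)

theorem isWeightedHomogeneous_zero_iff_exists_toCoordinateRing
    (hS : ∀ m, m ∈ dualLatticePoints σ ↔ ∀ i, 0 ≤ (M *ᵥ m) i) (f : MvPolynomial (Fin n) k) :
    IsWeightedHomogeneous (unitClass M) f 0 ↔ ∃ r, toCoordinateRing k hS r = f := by
  constructor
  · intro hf
    rw [← RingHom.mem_range, f.as_sum]
    refine sum_mem fun d hd => ?_
    obtain ⟨m, rfl⟩ := (weight_unitClass_eq_zero_iff hS d).1 (hf (mem_support_iff.1 hd))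
    exact ⟨_, toCoordinateRing_single k hS m _⟩
  · rintro ⟨r, rfl⟩
    induction r using AddMonoidAlgebra.induction_linear with
    | zero => rw [map_zero]; exact isWeightedHomogeneous_zero _ _ _
    | add x y hx hy => rw [map_add]; exact hx.add hy
    | single m c =>
      rw [toCoordinateRing_single]
      exact isWeightedHomogeneous_monomial _ _ _ ((weight_unitClass_eq_zero_iff hS _).2 ⟨m, rfl⟩)

theorem classGroup_and_hasUSTP_of_rows
    (hS : ∀ m, m ∈ dualLatticePoints σ ↔ ∀ i, 0 ≤ (M *ᵥ m) i) (hM : M.det ≠ 0)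
    (hrow : ∀ i, Finset.univ.gcd (M i) = 1) :
    Finite (DivisorClassGroup (ToricRing k σ)) ∧
      Nat.card (DivisorClassGroup (ToricRing k σ)) = M.det.natAbs ∧
      HasUSTPPureHeightOne (ToricRing k σ) M.det.natAbs := by
  have := finite_columnQuotient hM
  have hinj := toCoordinateRing_injective k hS hM
  have hι := isWeightedHomogeneous_zero_iff_exists_toCoordinateRing k hS
  have := isNoetherianRing_of_weight_zero _ hinj hι
  let T := weightZeroDivisorTheory _ hinj hι (exists_weight_eq hM)
    fun i => exists_weight_eq_of_gcd_row_eq_one hM i (hrow i)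
  have e := T.divisorClassGroupEquiv.toEquiv
  rw [← card_columnQuotient hM]
  exact ⟨Finite.of_equiv _ e.symm, Nat.card_congr e, T.hasUSTPPureHeightOne⟩

end Lattice


/-! ### Simplicial cones, their rays and dual cones, and the volume. -/

section Cones

open Matrix

variable {n : ℕ}

theorem span_hull {E : Type*} [AddCommGroup E] [Module ℝ E] (s : Set E) :
    Submodule.span ℝ (PointedCone.hull ℝ s : Set E) = Submodule.span ℝ s :=
  Submodule.span_span_of_tower _ _ _

theorem mem_hull_basis {ι E : Type*} [Fintype ι] [AddCommGroup E] [Module ℝ E]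
    (b : Module.Basis ι ℝ E) {x : E} :
    x ∈ PointedCone.hull ℝ (Set.range b) ↔ ∀ i, 0 ≤ b.repr x i := by
  constructor
  · intro hx i
    obtain ⟨c, rfl⟩ := (Submodule.mem_span_range_iff_exists_fun {c : ℝ // 0 ≤ c}).1 hx
    have : ∑ l, c l • b l = ∑ l, (c l : ℝ) • b l := rfl
    rw [this, b.repr_sum_self]
    exact (c i).2
  · intro h
    rw [← b.sum_repr x]
    exact sum_mem fun i _ => PointedCone.smul_mem _ (h i)
      (Submodule.subset_span (Set.mem_range_self i))

theorem mem_hull_singleton {E : Type*} [AddCommGroup E] [Module ℝ E] {x y : E} :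
    x ∈ PointedCone.hull ℝ {y} ↔ ∃ c : ℝ, 0 ≤ c ∧ c • y = x := by
  constructor
  · intro h
    obtain ⟨c, hc⟩ := Submodule.mem_span_singleton.1 h
    exact ⟨c, c.2, hc⟩
  · rintro ⟨c, hc, rfl⟩
    exact PointedCone.smul_mem _ hc (Submodule.subset_span rfl)

theorem isRay_hull_basis_singleton (b : Module.Basis (Fin n) ℝ (Fin n → ℝ)) (i : Fin n) :
    IsRay (PointedCone.hull ℝ {b i}) (PointedCone.hull ℝ (Set.range b)) := by
  refine ⟨⟨Submodule.span_mono (by rintro _ rfl; exact ⟨i, rfl⟩), ?_⟩, ?_⟩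
  · intro x y a hx hy ha h
    rw [mem_hull_basis] at hx hy
    obtain ⟨c, hc, hcx⟩ := mem_hull_singleton.1 h
    refine mem_hull_singleton.2 ⟨b.repr x i, hx i, b.ext_elem fun l => ?_⟩
    by_cases hl : l = i
    · subst hl; simp
    have h := DFunLike.congr_fun (congrArg b.repr hcx) l
    simp only [map_smul, map_add, Finsupp.smul_apply, Finsupp.add_apply, b.repr_self,
      Finsupp.single_eq_of_ne hl, smul_eq_mul, mul_zero] at h ⊢
    nlinarith [hx l, hy l, mul_nonneg ha.le (hx l)]
  · rw [span_hull, finrank_span_singleton (b.ne_zero i)]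

theorem latticeVec_injective : Function.Injective (latticeVec : (Fin n → ℤ) → Fin n → ℝ) :=
  fun _ _ h => funext fun i => Int.cast_injective (congrFun h i)

/-- Pairing with Bézout coefficients of v shows that c is an integer; it divides every coordinate of
u, so it is 1. -/
theorem eq_of_latticeVec_eq_smul {u v : Fin n → ℤ} (hu : Finset.univ.gcd u = 1)
    (hv : Finset.univ.gcd v = 1) {c : ℝ} (hc : 0 ≤ c) (h : latticeVec u = c • latticeVec v) :
    u = v := by
  obtain ⟨x, hx⟩ := Finset.gcd_eq_sum_mul Finset.univ v
  rw [hv] at hx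
  have hcN : ((∑ i, u i * x i : ℤ) : ℝ) = c := by
    have h1 : ((∑ i, v i * x i : ℤ) : ℝ) = 1 := by rw [← hx, Int.cast_one]
    push_cast at h1 ⊢
    rw [← mul_one c, ← h1, Finset.mul_sum]
    refine Finset.sum_congr rfl fun i _ => ?_
    have : (u i : ℝ) = c * v i := congrFun h i
    rw [this, mul_assoc]
  generalize (∑ i, u i * x i : ℤ) = N at hcN
  have huN : ∀ i, u i = N * v i := fun i => by
    have : (u i : ℝ) = c * v i := congrFun h i
    rw [← hcN] at this
    exact_mod_cast this
  have hN1 : N ∣ 1 := by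
    rw [← hu]
    exact Finset.dvd_gcd fun i _ => ⟨v i, huN i⟩
  have hN0 : 0 ≤ N := by rw [← hcN] at hc; exact_mod_cast hc
  have : N = 1 := Int.eq_one_of_dvd_one hN0 hN1
  ext i
  rw [huN, this, one_mul]

theorem ne_zero_of_gcd_eq_one {u : Fin n → ℤ} (hu : Finset.univ.gcd u = 1) : u ≠ 0 := by
  rintro rfl
  have : Finset.univ.gcd (0 : Fin n → ℤ) = 0 := Finset.gcd_eq_zero_iff.2 fun _ _ => rfl
  rw [this] at hu
  exact zero_ne_one hu

theorem primitiveRayGenerators_hull_basis (b : Module.Basis (Fin n) ℝ (Fin n → ℝ))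
    {v : Fin n → Fin n → ℤ} (hbv : ∀ i, b i = latticeVec (v i))
    (hv : ∀ i, Finset.univ.gcd (v i) = 1) :
    primitiveRayGenerators (PointedCone.hull ℝ (Set.range b)) = Set.range v := by
  ext u
  constructor
  · rintro ⟨hu, ρ, ⟨hface, hrank⟩, huρ⟩
    have hu0 : latticeVec u ≠ 0 := fun h => ne_zero_of_gcd_eq_one hu
      (latticeVec_injective (h.trans (by ext; simp [latticeVec])))
    have hnonneg := (mem_hull_basis b).1 (hface.le huρ)
    obtain ⟨i, hi⟩ : ∃ i, b.repr (latticeVec u) i ≠ 0 := by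
      by_contra! h
      exact hu0 (b.ext_elem fun i => by simp [h i])
    -- Split u as a positive multiple of `b i` plus a vector of the cone: a face containing the sum
    -- contains `b i`. As the face spans a line, u is a multiple of `b i`.
    have hbi : b i ∈ ρ := by
      refine hface.mem_of_smul_add_mem (a := b.repr (latticeVec u) i)
        (y := latticeVec u - b.repr (latticeVec u) i • b i)
        (Submodule.subset_span (Set.mem_range_self i)) ?_
        (lt_of_le_of_ne (hnonneg i) hi.symm) (by rwa [add_sub_cancel])
      rw [mem_hull_basis]
      intro l
      by_cases hl : l = i
      · subst hl; simp
      · simpa [Finsupp.single_eq_of_ne hl] using hnonneg l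
    obtain ⟨c, hc⟩ := (finrank_eq_one_iff_of_nonzero'
      (⟨b i, Submodule.subset_span hbi⟩ : Submodule.span ℝ (ρ : Set (Fin n → ℝ)))
      (fun h => b.ne_zero i (congrArg Subtype.val h))).1 hrank
      ⟨latticeVec u, Submodule.subset_span huρ⟩
    have hc : c • b i = latticeVec u := congrArg Subtype.val hc
    have hc0 : 0 ≤ c := by
      have := hnonneg i
      rw [← hc] at this
      simpa using this
    exact ⟨i, (eq_of_latticeVec_eq_smul hu (hv i) hc0 (by rw [← hbv, hc])).symm⟩
  · rintro ⟨i, rfl⟩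
    exact ⟨hv i, _, isRay_hull_basis_singleton b i,
      hbv i ▸ Submodule.subset_span (Set.mem_singleton _)⟩

theorem exists_primitive_pos_smul {g : Fin n → ℤ} (hg : g ≠ 0) :
    ∃ v : Fin n → ℤ, Finset.univ.gcd v = 1 ∧
      ∃ d : ℝ, 0 < d ∧ latticeVec g = d • latticeVec v := by
  have hne : (Finset.univ : Finset (Fin n)).Nonempty := by
    obtain ⟨i, -⟩ := Function.ne_iff.1 hg
    exact ⟨i, Finset.mem_univ i⟩
  obtain ⟨v, hv, hv1⟩ := Finset.extract_gcd g hne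
  refine ⟨v, hv1, (Finset.univ.gcd g : ℤ), ?_, ?_⟩
  · have h0 : 0 ≤ Finset.univ.gcd g := Int.nonneg_of_normalize_eq_self Finset.normalize_gcd
    have h1 : Finset.univ.gcd g ≠ 0 := fun h =>
      hg (funext fun i => Finset.gcd_eq_zero_iff.1 h i (Finset.mem_univ i))
    exact_mod_cast lt_of_le_of_ne h0 h1.symm
  · ext i
    simp [latticeVec, hv i]

theorem exists_basis_of_isSimplicial {σ : PointedCone ℝ (Fin n → ℝ)} (hfull : IsFull σ)
    (hsimp : IsSimplicial σ) :
    ∃ (b : Module.Basis (Fin n) ℝ (Fin n → ℝ)) (v : Fin n → Fin n → ℤ),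
      (∀ i, b i = latticeVec (v i)) ∧ (∀ i, Finset.univ.gcd (v i) = 1) ∧
        σ = PointedCone.hull ℝ (Set.range b) := by
  obtain ⟨G, hG, rfl⟩ := hsimp
  rw [IsFull, span_hull] at hfull
  let bG : Module.Basis G ℝ (Fin n → ℝ) := Module.Basis.mk (v := fun g : G => latticeVec g) hG
    (by rw [← hfull, Set.image_eq_range])
  let e : Fin n ≃ G := (bG.indexEquiv (Pi.basisFun ℝ (Fin n))).symm
  have hbG : ∀ g, bG g = latticeVec g := fun g => Module.Basis.mk_apply _ _ g
  have hne : ∀ i, (e i : Fin n → ℤ) ≠ 0 := fun i h => bG.ne_zero (e i) (by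
    rw [hbG, h]; ext; simp [latticeVec])
  choose v hv d hd hvd using fun i => exists_primitive_pos_smul (hne i)
  -- Positive rescaling makes the generators primitive and leaves the cone unchanged.
  let b := (bG.reindex e.symm).isUnitSMul (w := fun i => (d i)⁻¹)
    fun i => (inv_ne_zero (hd i).ne').isUnit
  have hb : ∀ i, b i = latticeVec (v i) := fun i => by
    simp only [b, Module.Basis.isUnitSMul_apply, Module.Basis.reindex_apply, Equiv.symm_symm, hbG]
    rw [hvd, inv_smul_smul₀ (hd i).ne']
  refine ⟨b, v, hb, hv, le_antisymm (Submodule.span_le.2 ?_) (Submodule.span_le.2 ?_)⟩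
  · rintro _ ⟨g, hg, rfl⟩
    obtain ⟨i, hi⟩ := e.surjective ⟨g, hg⟩
    have : g = e i := by rw [hi]
    rw [this, hvd, ← hb]
    exact PointedCone.smul_mem _ (hd i).le (Submodule.subset_span (Set.mem_range_self i))
  · rintro _ ⟨i, rfl⟩
    have : b i = (d i)⁻¹ • latticeVec (e i) := by rw [hvd, inv_smul_smul₀ (hd i).ne', hb]
    rw [this]
    exact PointedCone.smul_mem _ (inv_nonneg.2 (hd i).le)
      (Submodule.subset_span ⟨e i, (e i).2, rfl⟩)

theorem mem_dualLatticePoints_hull_basis (b : Module.Basis (Fin n) ℝ (Fin n → ℝ))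
    {M : Matrix (Fin n) (Fin n) ℤ} (hb : ∀ i, b i = latticeVec (M i)) (m : Fin n → ℤ) :
    m ∈ dualLatticePoints (PointedCone.hull ℝ (Set.range b)) ↔ ∀ i, 0 ≤ (M *ᵥ m) i := by
  have key : ∀ i, latticeVec m ⬝ᵥ b i = ((M *ᵥ m) i : ℤ) := fun i => by
    rw [hb, dotProduct_comm]
    simp [latticeVec, dotProduct, mulVec]
  constructor
  · intro h i
    have := h (b i) (Submodule.subset_span (Set.mem_range_self i))
    rw [key] at this
    exact_mod_cast this
  · intro h x hx
    rw [mem_hull_basis] at hx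
    rw [← b.sum_repr x, dotProduct_sum]
    refine Finset.sum_nonneg fun i _ => ?_
    rw [dotProduct_smul, key]
    exact mul_nonneg (hx i) (by exact_mod_cast h i)

theorem linearIndependent_latticeVec_iff_det_ne_zero (M : Matrix (Fin n) (Fin n) ℤ) :
    LinearIndependent ℝ (fun i => latticeVec (M i)) ↔ M.det ≠ 0 := by
  have h : (M.map (Int.cast : ℤ → ℝ)).row = fun i => latticeVec (M i) := rfl
  rw [← h, linearIndependent_rows_iff_isUnit, isUnit_iff_isUnit_det,
    show M.map (Int.cast : ℤ → ℝ) = (Int.castRingHom ℝ).mapMatrix M from rfl,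
    ← RingHom.map_det, isUnit_iff_ne_zero]
  simp

theorem volume_parallelepiped_latticeVec (M : Matrix (Fin n) (Fin n) ℤ) :
    MeasureTheory.volume (parallelepiped fun i => latticeVec (M i)) =
      (M.det.natAbs : ENNReal) := by
  have h := MeasureTheory.Measure.addHaar_parallelepiped (Pi.basisFun ℝ (Fin n))
    fun i => latticeVec (M i)
  rw [Module.Basis.addHaar, Module.Basis.parallelepiped_basisFun,
    MeasureTheory.addHaarMeasure_eq_volume_pi, Pi.basisFun_det] at h
  rw [h]
  have hdet : detRowAlternating (fun i => latticeVec (M i)) = ((M.det : ℤ) : ℝ) :=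
    ((Int.castRingHom ℝ).map_det M).symm
  rw [hdet, ← Int.cast_abs, Int.abs_eq_natAbs, Int.cast_natCast, ENNReal.ofReal_natCast]

end Cones

end ToricUSTP

open ToricUSTP in
/-- A full-dimensional simplicial strongly convex rational polyhedral cone `σ ⊆ ℝⁿ` has exactly `n`
primitive ray generators; however they are listed, with `D = |det A_G|`, `D` is the volume of the
parallelotope they span, `Cl(U_σ)` is finite of order `D`, and the toric ring satisfies the uniform
symbolic topology property on ideals of pure height one with multiplier `D`. -/
theorem theorem1p3 {k : Type*} [Field k] [IsAlgClosed k] {n : ℕ}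
    (σ : PointedCone ℝ (Fin n → ℝ))
    (hrat : IsRationalPolyhedral σ) (hconv : IsStronglyConvex σ)
    (hfull : IsFull σ) (hsimp : IsSimplicial σ) :
    Nonempty (Fin n ≃ primitiveRayGenerators σ) ∧
    ∀ e : Fin n ≃ primitiveRayGenerators σ, ∀ D : ℕ, D = (rayMatrix σ e).det.natAbs →
      MeasureTheory.volume (parallelepiped fun i => latticeVec (e i : Fin n → ℤ)) = (D : ENNReal) ∧
      Finite (DivisorClassGroup (ToricRing k σ)) ∧
      Nat.card (DivisorClassGroup (ToricRing k σ)) = D ∧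
      HasUSTPPureHeightOne (ToricRing k σ) D := by
  obtain ⟨b, v, hb, hv, hσ⟩ := exists_basis_of_isSimplicial hfull hsimp
  have hgen : primitiveRayGenerators σ = Set.range v := by
    rw [hσ]; exact primitiveRayGenerators_hull_basis b hb hv
  have hvinj : Function.Injective v := fun i l h => b.injective (by rw [hb, hb, h])
  refine ⟨⟨(Equiv.ofInjective v hvinj).trans (Equiv.setCongr hgen.symm)⟩, ?_⟩
  rintro e _ rfl
  -- The given listing of the ray generators differs from v by a permutation, along which the basis
  -- is reindexed.
  let π : Fin n ≃ Fin n :=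
    (e.trans (Equiv.setCongr hgen)).trans (Equiv.ofInjective v hvinj).symm
  have hπ : ∀ i, v (π i) = rayMatrix σ e i := fun i =>
    congrArg Subtype.val
      ((Equiv.ofInjective v hvinj).apply_symm_apply ((e.trans (Equiv.setCongr hgen)) i))
  let b' := b.reindex π.symm
  have hb' : ∀ i, b' i = latticeVec (rayMatrix σ e i) := fun i => by
    simp [b', hb, hπ]
  have hσ' : σ = PointedCone.hull ℝ (Set.range b') := by rw [hσ, b.range_reindex]
  have hdet : (rayMatrix σ e).det ≠ 0 := by
    rw [← linearIndependent_latticeVec_iff_det_ne_zero]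
    simpa only [← hb'] using b'.linearIndependent
  have hS : ∀ m, m ∈ dualLatticePoints σ ↔ ∀ i, 0 ≤ (rayMatrix σ e).mulVec m i := fun m => by
    rw [← mem_dualLatticePoints_hull_basis b' hb', ← hσ']
  exact ⟨volume_parallelepiped_latticeVec (rayMatrix σ e),
    classGroup_and_hasUSTP_of_rows k hS hdet fun i => hπ i ▸ hv (π i)⟩
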